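/- Let $p=(p_{ij})$ be an $n\times n$ matrix with non-negative real entries and let $\gamma\in[-1,1]$. Let $\beta=(\beta_{ij})$ be a doubly stochastic $n\times n$ matrix (non-negative entries, all row and column sums equal to $1$) with $\beta_{ij}=0$ whenever $p_{ij}=0$ and $\beta_{ij}\notin\{0,1\}$ whenever $p_{ij}\neq 0$. Suppose that $\beta$ solves the fractional equations at parameter $\gamma$, that is, there are positive reals $w_1,\dots,w_n$ and $w^1,\dots,w^n$ with $$\frac{\beta_{ij}}{(1-\beta_{ij})^{\gamma}}=\frac{p_{ij}}{w_i\,w^j}\qquad\text{for all } i,j.$$ Put $$Z_f^{(\gamma)}(\beta|p)=\exp\Bigl(-\sum_{i,j=1}^n\bigl(\beta_{ij}\log(\beta_{ij}/p_{ij})+\gamma(1-\beta_{ij})\log(1-\beta_{ij})\bigr)\Bigr),$$ where terms $\beta_{ij}\log(\beta_{ij}/p_{ij})$ with $\beta_{ij}=p_{ij}=0$ are read as $0$. Then $$\operatorname{perm}(p)\ \ge\ Z_f^{(\gamma)}(\beta|p)\,\frac{n!}{n^n}\,\prod_{i,j=1}^n(1-\beta_{ij})^{\gamma(1-\beta_{ij})}.$$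 -/

import Mathlib

/-- The `β`-polytope of a matrix `p`: the doubly stochastic matrices that vanish wherever `p` does. -/
def betaPolytope {n : ℕ} (p : Matrix (Fin n) (Fin n) ℝ) : Set (Matrix (Fin n) (Fin n) ℝ) :=
  {β | β ∈ doublyStochastic ℝ (Fin n) ∧ ∀ i j, p i j = 0 → β i j = 0}

/-- The interior of the `β`-polytope: the entries of `β` on the support of `p` are neither `0`
nor `1`. -/
def betaPolytopeInterior {n : ℕ} (p : Matrix (Fin n) (Fin n) ℝ) :
    Set (Matrix (Fin n) (Fin n) ℝ) :=
  {β | β ∈ betaPolytope p ∧ ∀ i j, p i j ≠ 0 → β i j ≠ 0 ∧ β i j ≠ 1}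

/-- `β` solves the fractional equations at parameter `γ`, for some positive multipliers `w i` of the
row constraints and `v j` of the column constraints. -/
def SolvesFractionalEquations {n : ℕ} (γ : ℝ) (p β : Matrix (Fin n) (Fin n) ℝ) : Prop :=
  ∃ w v : Fin n → ℝ, (∀ i, 0 < w i) ∧ (∀ j, 0 < v j) ∧
    ∀ i j, β i j / (1 - β i j) ^ γ = p i j / (w i * v j)

/-- The fractional free energy at parameter `γ`. The conventions `0 / 0 = 0` and `Real.log 0 = 0`
make the entries with `p i j = 0`, `β i j = 0` contribute `0`. -/
noncomputable def fractionalFreeEnergy {n : ℕ} (γ : ℝ) (β p : Matrix (Fin n) (Fin n) ℝ) : ℝ :=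
  ∑ i, ∑ j, (β i j * Real.log (β i j / p i j) + γ * (1 - β i j) * Real.log (1 - β i j))

/-- The fractional partition function: minus its logarithm is the fractional free energy. -/
noncomputable def fractionalZ {n : ℕ} (γ : ℝ) (β p : Matrix (Fin n) (Fin n) ℝ) : ℝ :=
  Real.exp (-fractionalFreeEnergy γ β p)

/-! The product over `γ` cancels the `γ` terms of the free energy (`fractionalZ_mul_prod`), leaving
`perm p ≥ c * n! / n ^ n` with `c = exp (-∑ β log (β / p))`. This is Gurvits' capacity method. Let
`P x = ∏ i, ∑ j, p i j * x j`; its coefficient at `x₁⋯xₙ` is the permanent. Weighted AM-GM in each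
row, with weights `β i j`, gives `c * ∏ x j ≤ P x` for positive `x`. Extracting the linear
coefficient in one variable at a time keeps stability and homogeneity, and costs a factor `(n / (n +
1)) ^ n` when passing from `n + 1` variables to `n`; these factors multiply to `n! / n ^ n`. -/

/-! ### Univariate polynomials. -/

/-- A complex polynomial of positive degree without zeros in the closed right half-plane has a
nonzero linear coefficient. -/
theorem Polynomial.coeff_one_ne_zero_of_forall_re_nonneg {f : Polynomial ℂ}
    (hf : ∀ z : ℂ, 0 ≤ z.re → f.eval z ≠ 0) (hd : 0 < f.natDegree) : f.coeff 1 ≠ 0 := by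
  have h0 : f.eval 0 ≠ 0 := hf 0 (by simp)
  have hs : f.Splits := IsAlgClosed.splits f
  have key := hs.eval_derivative_div_eval_of_ne_zero h0
  have hder : f.derivative.eval 0 = f.coeff 1 := by
    rw [← Polynomial.coeff_zero_eq_eval_zero, Polynomial.coeff_derivative]; simp
  intro hc
  -- `f'(0) / f(0)` is the sum of `-1 / z` over the roots, and each term has positive real part.
  rw [hder, hc, zero_div] at key
  have hre := congrArg Complex.reAddGroupHom key
  rw [map_multiset_sum, Multiset.map_map] at hre
  have hne : f.roots ≠ 0 := by
    rw [← Multiset.card_pos, ← hs.natDegree_eq_card_roots]; exact hd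
  have hpos : ∀ z ∈ f.roots, 0 < (1 / (0 - z) : ℂ).re := by
    intro z hz
    have hr : z.re < 0 := by
      by_contra! h
      exact hf z h (Polynomial.isRoot_of_mem_roots hz)
    have hz0 : z ≠ 0 := by rintro rfl; simp at hr
    rw [zero_sub, one_div, Complex.inv_re]
    exact div_pos (by simpa using hr) (Complex.normSq_pos.2 (neg_ne_zero.2 hz0))
  have := Multiset.sum_lt_sum_of_nonempty (f := fun _ ↦ (0 : ℝ)) hne hpos
  simp only [Multiset.map_const', Multiset.sum_replicate, smul_zero] at this
  have h2 : (0 : ℝ) = (f.roots.map fun z ↦ (1 / (0 - z) : ℂ).re).sum := by simpa using! hre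
  exact this.ne h2

/-- The arithmetic-geometric mean inequality for a multiset of positive reals, with the mean `m`. -/
theorem Multiset.prod_le_pow_card_of_sum_eq {s : Multiset ℝ} (hs : ∀ x ∈ s, 0 ≤ x) {m : ℝ}
    (hm : 0 < m) (h : s.sum = s.card * m) : s.prod ≤ m ^ s.card := by
  -- From `1 + u ≤ exp u`; the exponents `x / m - 1` add up to zero.
  have h1 : (s.map fun x ↦ x).prod ≤ (s.map fun x ↦ m * Real.exp (x / m - 1)).prod := by
    refine Multiset.prod_map_le_prod_map₀ _ _ hs fun x _ ↦ ?_
    have := Real.add_one_le_exp (x / m - 1)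
    calc x = m * (x / m - 1 + 1) := by field_simp; ring
      _ ≤ _ := by gcongr
  rw [Multiset.map_id'] at h1
  refine h1.trans (le_of_eq ?_)
  rw [Multiset.prod_map_mul, Multiset.map_const', Multiset.prod_replicate]
  have : (s.map fun x ↦ Real.exp (x / m - 1)).prod = Real.exp (s.map fun x ↦ x / m - 1).sum := by
    rw [Real.exp_multiset_sum, Multiset.map_map]; rfl
  rw [this, Multiset.sum_map_sub, Multiset.sum_map_div, Multiset.map_id', h]
  simp [hm.ne']

/-- Gurvits' univariate inequality: a bound `c * t ≤ f t` for a real-rooted polynomial with negative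
roots gives a lower bound for its linear coefficient. -/
theorem Polynomial.Splits.mul_pow_le_coeff_one {f : Polynomial ℝ} (hs : f.Splits)
    (hr : ∀ r ∈ f.roots, r < 0) {n : ℕ} (hn : 0 < n) (hd : f.natDegree = n + 1) {c : ℝ}
    (hc : 0 < c) (hcap : ∀ t, 0 < t → c * t ≤ f.eval t) :
    c * ((n : ℝ) / (n + 1)) ^ n ≤ f.coeff 1 := by
  have hf0 : f ≠ 0 := by rintro rfl; simp at hd
  have hcard : f.roots.card = n + 1 := by rw [← hs.natDegree_eq_card_roots, hd]
  have h0 : f.eval 0 ≠ 0 := fun h ↦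
    lt_irrefl _ (hr 0 ((Polynomial.mem_roots hf0).2 h))
  have hder : f.derivative.eval 0 = f.coeff 1 := by
    rw [← Polynomial.coeff_zero_eq_eval_zero, Polynomial.coeff_derivative]; simp
  have key := hs.eval_derivative_div_eval_of_ne_zero h0
  rw [hder] at key
  set s := (f.roots.map fun z ↦ 1 / (0 - z)).sum with hsdef
  have hspos : 0 < s := by
    have hne : f.roots ≠ 0 := by rw [← Multiset.card_pos, hcard]; omega
    have := Multiset.sum_lt_sum_of_nonempty (f := fun _ ↦ (0 : ℝ))
      (g := fun z ↦ 1 / (0 - z)) hne fun z hz ↦ one_div_pos.2 (by linarith [hr z hz])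
    simpa only [Multiset.map_const', Multiset.sum_replicate, smul_zero] using this
  have heval : ∀ t, f.eval t = f.eval 0 * (f.roots.map fun z ↦ 1 + t * (1 / (0 - z))).prod := by
    intro t
    rw [hs.eval_eq_prod_roots t, hs.eval_eq_prod_roots 0, mul_assoc, ← Multiset.prod_map_mul]
    congr 2
    refine Multiset.map_congr rfl fun z hz ↦ ?_
    have := (hr z hz).ne
    field_simp
    ring
  have hfac : ∀ t, 0 < t → ∀ x ∈ f.roots.map fun z ↦ 1 + t * (1 / (0 - z)), 0 < x := by
    intro t ht x hx
    obtain ⟨z, hz, rfl⟩ := Multiset.mem_map.1 hx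
    have : 0 < 1 / (0 - z) := one_div_pos.2 (by linarith [hr z hz])
    positivity
  have hpos : 0 < f.eval 0 := by
    have h1 := hcap 1 one_pos
    rw [heval 1, mul_one] at h1
    exact pos_of_mul_pos_left (hc.trans_le h1) (Multiset.prod_nonneg fun x hx ↦ (hfac 1 one_pos x hx).le)
  have hn' : (0 : ℝ) < n := by exact_mod_cast hn
  -- The minimiser of `(1 + t * s / (n + 1)) ^ (n + 1) / t`; there the factors `1 - t / z` have mean
  -- `(n + 1) / n`.
  set t : ℝ := (n + 1) / (n * s) with htdef
  have ht : 0 < t := by positivity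
  have hprod : (f.roots.map fun z ↦ 1 + t * (1 / (0 - z))).prod ≤ (((n : ℝ) + 1) / n) ^ (n + 1) := by
    have := Multiset.prod_le_pow_card_of_sum_eq (fun x hx ↦ (hfac t ht x hx).le)
      (m := ((n : ℝ) + 1) / n) (by positivity) (by
        rw [Multiset.sum_map_add, Multiset.sum_map_mul_left, ← hsdef]
        simp only [Multiset.map_const', Multiset.sum_replicate, Multiset.card_map, hcard]
        rw [htdef]; push_cast; field_simp; simp; field_simp)
    simpa [hcard] using this
  have h2 : c * t ≤ f.eval 0 * (((n : ℝ) + 1) / n) ^ (n + 1) :=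
    (hcap t ht).trans (by rw [heval t]; gcongr)
  have hcoeff : f.coeff 1 = f.eval 0 * s := by rw [← key]; field_simp
  rw [hcoeff]
  have h3 : c * ((n : ℝ) / (n + 1)) ^ n
      = c * t * (s * ((n : ℝ) / (n + 1)) ^ (n + 1)) := by
    rw [htdef, pow_succ]; field_simp
  rw [h3]
  calc _ ≤ f.eval 0 * (((n : ℝ) + 1) / n) ^ (n + 1) * (s * ((n : ℝ) / (n + 1)) ^ (n + 1)) := by gcongr
    _ = f.eval 0 * s * ((((n : ℝ) + 1) / n) * (n / (n + 1))) ^ (n + 1) := by rw [mul_pow]; ring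
    _ = _ := by rw [div_mul_div_comm, mul_comm ((n : ℝ) + 1), div_self (by positivity)]; simp

/-! ### Stable homogeneous polynomials and capacity. -/

namespace MvPolynomial

theorem IsHomogeneous.aeval_smul_pow {σ R A : Type*} [CommSemiring R] [CommSemiring A] [Algebra R A]
    {P : MvPolynomial σ R} {n : ℕ} (hP : P.IsHomogeneous n) (c : A) (x : σ → A) :
    MvPolynomial.aeval (fun i ↦ c * x i) P = c ^ n * MvPolynomial.aeval x P := by
  rw [aeval_def, aeval_def, eval₂_eq, eval₂_eq, Finset.mul_sum]
  refine Finset.sum_congr rfl fun d hd ↦ ?_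
  have hdeg := hP.degree_eq_sum_deg_support hd
  simp only [mul_pow, Finset.prod_mul_distrib, Finset.prod_pow_eq_pow_sum]
  rw [hdeg]
  ring

theorem IsHomogeneous.aeval_zero_of_pos {σ R A : Type*} [CommSemiring R] [CommSemiring A]
    [Algebra R A] {P : MvPolynomial σ R} {n : ℕ} (hP : P.IsHomogeneous n) (hn : 0 < n) :
    MvPolynomial.aeval (0 : σ → A) P = 0 := by
  rw [aeval_zero, constantCoeff_eq, hP.coeff_eq_zero (by simpa using hn.ne), map_zero]

/-- The univariate polynomial obtained by fixing all variables of `P` but the first. -/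
noncomputable def fiber {n : ℕ} {R A : Type*} [CommSemiring R] [CommSemiring A] [Algebra R A]
    (P : MvPolynomial (Fin (n + 1)) R) (z : Fin n → A) : Polynomial A :=
  (finSuccEquiv R n P).map (aeval z : MvPolynomial (Fin n) R →ₐ[R] A).toRingHom

theorem coeff_fiber {n : ℕ} {R A : Type*} [CommSemiring R] [CommSemiring A] [Algebra R A]
    (P : MvPolynomial (Fin (n + 1)) R) (z : Fin n → A) (i : ℕ) :
    (P.fiber z).coeff i = aeval z ((finSuccEquiv R n P).coeff i) := by
  simp [fiber]

theorem eval_fiber {n : ℕ} {R A : Type*} [CommSemiring R] [CommSemiring A] [Algebra R A]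
    (P : MvPolynomial (Fin (n + 1)) R) (z : Fin n → A) (t : A) :
    (P.fiber z).eval t = aeval (Fin.cons t z : Fin (n + 1) → A) P := by
  induction P using MvPolynomial.induction_on with
  | C a => simp [fiber, finSuccEquiv_apply]
  | add p q hp hq =>
    simp only [fiber, map_add, Polynomial.map_add, Polynomial.eval_add] at *
    rw [hp, hq]
  | mul_X p j hp =>
    simp only [fiber, map_mul, Polynomial.map_mul, Polynomial.eval_mul, aeval_X] at *
    rw [hp]
    congr 1
    refine Fin.cases ?_ (fun j ↦ ?_) j <;> simp [finSuccEquiv_X_zero, finSuccEquiv_X_succ]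

theorem map_fiber {n : ℕ} (P : MvPolynomial (Fin (n + 1)) ℝ) (x : Fin n → ℝ) :
    (P.fiber x).map Complex.ofRealHom = P.fiber fun i ↦ (x i : ℂ) := by
  ext i
  rw [Polynomial.coeff_map, coeff_fiber, coeff_fiber]
  exact (aeval_algebraMap_apply ℂ x _).symm

theorem IsHomogeneous.natDegree_fiber_le {n m : ℕ} {R A : Type*} [CommSemiring R] [CommSemiring A]
    [Algebra R A] {P : MvPolynomial (Fin (n + 1)) R} (hP : P.IsHomogeneous m) (z : Fin n → A) :
    (P.fiber z).natDegree ≤ m :=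
  Polynomial.natDegree_map_le.trans <| (natDegree_finSuccEquiv P).le.trans <|
    (degreeOf_le_totalDegree P 0).trans hP.totalDegree_le

/-- A real polynomial is right half-plane stable if it does not vanish at complex points whose
coordinates have non-negative real parts, not all zero. -/
def RightStable {σ : Type*} (P : MvPolynomial σ ℝ) : Prop :=
  ∀ z : σ → ℂ, (∀ i, 0 ≤ (z i).re) → (∃ i, 0 < (z i).re) → aeval z P ≠ 0

/-- The coefficient of `X 0 ^ m` is a constant, so it does not depend on `z`; it equals `P (1, 0, …,
0)`, which stability makes nonzero. -/
theorem RightStable.natDegree_fiber {n m : ℕ} {P : MvPolynomial (Fin (n + 1)) ℝ}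
    (hS : P.RightStable) (hP : P.IsHomogeneous m) (z : Fin n → ℂ) :
    (P.fiber z).natDegree = m := by
  refine le_antisymm (hP.natDegree_fiber_le z) (Polynomial.le_natDegree_of_ne_zero ?_)
  have h1 : (P.fiber (0 : Fin n → ℂ)).eval 1 ≠ 0 := by
    rw [eval_fiber]
    refine hS _ (fun i ↦ ?_) ⟨0, by simp⟩
    refine Fin.cases ?_ (fun j ↦ ?_) i <;> simp
  rw [Polynomial.eval_eq_sum_range' (Nat.lt_succ_of_le (hP.natDegree_fiber_le _)),
    Finset.sum_range_succ, Finset.sum_eq_zero fun i hi ↦ ?_] at h1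
  · have h0 : ((finSuccEquiv ℝ n P).coeff m).IsHomogeneous 0 :=
      hP.finSuccEquiv_coeff_isHomogeneous m 0 (add_zero m)
    have hC := totalDegree_eq_zero_iff_eq_C.1 ((totalDegree_zero_iff_isHomogeneous _).2 h0)
    rw [coeff_fiber, hC, aeval_C] at h1 ⊢
    simpa using h1
  · have hi := Finset.mem_range.1 hi
    rw [coeff_fiber, (hP.finSuccEquiv_coeff_isHomogeneous i (m - i) (by omega)).aeval_zero_of_pos
      (by omega), zero_mul]

/-- As `z` already has a coordinate of positive real part, the fiber has no zero even on the
imaginary axis. -/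
theorem RightStable.coeff_one {n m : ℕ} {P : MvPolynomial (Fin (n + 1)) ℝ}
    (hS : P.RightStable) (hP : P.IsHomogeneous m) (hm : 0 < m) :
    ((finSuccEquiv ℝ n P).coeff 1).RightStable := by
  rintro z hz ⟨i, hi⟩
  rw [← coeff_fiber]
  refine Polynomial.coeff_one_ne_zero_of_forall_re_nonneg (fun t ht ↦ ?_)
    (by rwa [hS.natDegree_fiber hP z])
  rw [eval_fiber]
  refine hS _ (fun j ↦ ?_) ⟨i.succ, by simpa using hi⟩
  refine Fin.cases ?_ (fun j ↦ ?_) j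
  · simpa using ht
  · simpa using hz j

/-- By homogeneity zeros may be rotated: unless `t` is a negative real, one rotation brings `t` and
the positive reals into the right half-plane together. -/
theorem RightStable.fiber_root {n m : ℕ} {P : MvPolynomial (Fin (n + 1)) ℝ}
    (hS : P.RightStable) (hP : P.IsHomogeneous m) {x : Fin n → ℝ} (hx : ∀ i, 0 < x i) (hn : 0 < n)
    {t : ℂ} (ht : (P.fiber fun i ↦ (x i : ℂ)).eval t = 0) : t.re < 0 ∧ t.im = 0 := by
  rw [eval_fiber] at ht
  by_contra hcon
  have hslit : t ∈ Complex.slitPlane ∨ t = 0 := by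
    rw [Complex.mem_slitPlane_iff]
    by_contra! h
    refine hcon ⟨lt_of_le_of_ne h.1.1 fun h0 ↦ h.2 (Complex.ext h0 h.1.2), h.1.2⟩
  obtain ⟨l, hl, hlt⟩ : ∃ l : ℂ, 0 < l.re ∧ 0 ≤ (l * t).re := by
    rcases hslit with h | rfl
    · have ht0 := Complex.slitPlane_ne_zero h
      -- Rotating by half the argument leaves `l` and `l * t` at angles `∓ arg t / 2`, of size below
      -- `π / 2`.
      refine ⟨Complex.exp (-(t.arg / 2 : ℝ) * Complex.I), ?_, ?_⟩
      · rw [← Complex.ofReal_neg, Complex.exp_ofReal_mul_I_re]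
        refine Real.cos_pos_of_mem_Ioo ⟨?_, ?_⟩ <;>
          linarith [Complex.neg_pi_lt_arg t, Complex.arg_le_pi t,
            lt_of_le_of_ne (Complex.arg_le_pi t) (Complex.slitPlane_arg_ne_pi h)]
      · have : Complex.exp (-(t.arg / 2 : ℝ) * Complex.I) * t
            = (‖t‖ : ℂ) * Complex.exp ((t.arg / 2 : ℝ) * Complex.I) := by
          conv_lhs => rw [← Complex.norm_mul_exp_arg_mul_I t]
          rw [mul_left_comm, ← Complex.exp_add]
          congr 2
          simp
          ring
        rw [this, Complex.re_ofReal_mul, Complex.exp_ofReal_mul_I_re]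
        refine mul_nonneg (norm_nonneg _) (Real.cos_nonneg_of_mem_Icc ⟨?_, ?_⟩) <;>
          linarith [Complex.neg_pi_lt_arg t, Complex.arg_le_pi t]
    · exact ⟨1, by simp, by simp⟩
  have h0 := hP.aeval_smul_pow l (Fin.cons t fun i ↦ (x i : ℂ) : Fin (n + 1) → ℂ)
  rw [ht, mul_zero] at h0
  refine hS _ (fun i ↦ ?_) ⟨Fin.succ ⟨0, hn⟩, ?_⟩ h0
  · refine Fin.cases ?_ (fun j ↦ ?_) i
    · simpa using hlt
    · simpa using mul_nonneg hl.le (hx j).le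
  · rw [Fin.cons_succ, mul_comm, Complex.re_ofReal_mul]
    exact mul_pos (hx _) hl

theorem RightStable.mul_pow_le_coeff_one {n : ℕ} {P : MvPolynomial (Fin (n + 1)) ℝ}
    (hS : P.RightStable) (hP : P.IsHomogeneous (n + 1)) {c : ℝ} (hc : 0 < c)
    (hcap : ∀ x : Fin (n + 1) → ℝ, (∀ i, 0 < x i) → c * ∏ i, x i ≤ aeval x P)
    {x : Fin n → ℝ} (hx : ∀ i, 0 < x i) :
    c * ((n : ℝ) / (n + 1)) ^ n * ∏ i, x i ≤ aeval x ((finSuccEquiv ℝ n P).coeff 1) := by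
  have hcap' : ∀ t, 0 < t → (c * ∏ i, x i) * t ≤ (P.fiber x).eval t := by
    intro t ht
    rw [eval_fiber]
    refine le_trans (le_of_eq ?_) (hcap (Fin.cons t x) fun i ↦ ?_)
    · rw [Fin.prod_univ_succ]; simp; ring
    · refine Fin.cases ?_ (fun j ↦ ?_) i
      · simpa using ht
      · simpa using hx j
  have hprod : 0 < ∏ i, x i := Finset.prod_pos fun i _ ↦ hx i
  rw [← coeff_fiber]
  -- For `n = 0` the fiber is a multiple of `t`, with root `0`, and the lost factor is `0 ^ 0 = 1`.
  rcases Nat.eq_zero_or_pos n with rfl | hn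
  · have h1 := hcap' 1 one_pos
    rw [Polynomial.eval_eq_sum_range' (Nat.lt_succ_of_le (hP.natDegree_fiber_le x)),
      Finset.sum_range_succ, Finset.sum_range_one, coeff_fiber, Subsingleton.elim x 0,
      (hP.finSuccEquiv_coeff_isHomogeneous 0 1 rfl).aeval_zero_of_pos one_pos] at h1
    simpa [Subsingleton.elim x 0] using h1
  · have hinj := Complex.ofRealHom.injective
    have hroot : ∀ a ∈ ((P.fiber x).map Complex.ofRealHom).roots, a.re < 0 ∧ a.im = 0 := by
      intro a ha
      rw [map_fiber] at ha
      exact hS.fiber_root hP hx hn (Polynomial.isRoot_of_mem_roots ha)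
    have hs : (P.fiber x).Splits := by
      refine Polynomial.Splits.of_splits_map Complex.ofRealHom (IsAlgClosed.splits _) fun a ha ↦ ?_
      exact ⟨a.re, Complex.ext rfl (by simpa using (hroot a ha).2.symm)⟩
    have hd : (P.fiber x).natDegree = n + 1 := by
      rw [← Polynomial.natDegree_map_eq_of_injective hinj, map_fiber, hS.natDegree_fiber hP]
    have := hs.mul_pow_le_coeff_one (fun r hr ↦ ?_) hn hd (mul_pos hc hprod) hcap'
    · linarith
    · have := (hroot r (by rw [hs.roots_map]; exact Multiset.mem_map_of_mem _ hr)).1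
      simpa using this

/-- Gurvits' capacity inequality for stable homogeneous polynomials. -/
theorem RightStable.mul_factorial_div_pow_le_coeff {n : ℕ} {P : MvPolynomial (Fin n) ℝ}
    (hS : P.RightStable) (hP : P.IsHomogeneous n) {c : ℝ} (hc : 0 < c)
    (hcap : ∀ x : Fin n → ℝ, (∀ i, 0 < x i) → c * ∏ i, x i ≤ aeval x P) :
    c * ((n.factorial : ℝ) / (n : ℝ) ^ n) ≤ coeff (Finsupp.equivFunOnFinite.symm fun _ ↦ 1) P := by
  induction n generalizing c with
  | zero =>
    have h := hcap 0 fun i ↦ i.elim0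
    rw [aeval_zero, constantCoeff_eq] at h
    rw [Subsingleton.elim (Finsupp.equivFunOnFinite.symm _) (0 : Fin 0 →₀ ℕ)]
    simpa using h
  | succ n ih =>
    have hpow : (0 : ℝ) < ((n : ℝ) / (n + 1)) ^ n := by
      rcases Nat.eq_zero_or_pos n with rfl | hn
      · simp
      · have : (0 : ℝ) < n := by exact_mod_cast hn
        positivity
    have h := ih (hS.coeff_one hP n.succ_pos)
      (hP.finSuccEquiv_coeff_isHomogeneous 1 n (add_comm 1 n)) (mul_pos hc hpow)
      fun x hx ↦ hS.mul_pow_le_coeff_one hP hc hcap hx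
    rw [finSuccEquiv_coeff_coeff] at h
    have hcons : Finsupp.cons 1 (Finsupp.equivFunOnFinite.symm fun _ : Fin n ↦ 1)
        = (Finsupp.equivFunOnFinite.symm fun _ ↦ 1 : Fin (n + 1) →₀ ℕ) := by
      ext i
      refine Fin.cases ?_ (fun j ↦ ?_) i <;> simp
    rw [hcons] at h
    refine le_trans (le_of_eq ?_) h
    have hn0 : (n : ℝ) ^ n ≠ 0 := by
      rcases Nat.eq_zero_or_pos n with rfl | hn
      · simp
      · positivity
    rw [Nat.factorial_succ, div_pow]
    push_cast
    rw [pow_succ]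
    field_simp

end MvPolynomial

/-! ### The permanent as a coefficient, and its capacity bound. -/

namespace Matrix

open MvPolynomial

/-- The product of the linear forms given by the rows of a matrix. -/
noncomputable def rowProduct {n : ℕ} (p : Matrix (Fin n) (Fin n) ℝ) : MvPolynomial (Fin n) ℝ :=
  ∏ i, ∑ j, C (p i j) * X j

theorem aeval_rowProduct {n : ℕ} {A : Type*} [CommSemiring A] [Algebra ℝ A]
    (p : Matrix (Fin n) (Fin n) ℝ) (x : Fin n → A) :
    aeval x p.rowProduct = ∏ i, ∑ j, algebraMap ℝ A (p i j) * x j := by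
  simp [rowProduct]

theorem isHomogeneous_rowProduct {n : ℕ} (p : Matrix (Fin n) (Fin n) ℝ) :
    p.rowProduct.IsHomogeneous n := by
  have := IsHomogeneous.prod Finset.univ (fun i ↦ ∑ j, C (p i j) * X j) (fun _ ↦ 1)
    fun i _ ↦ IsHomogeneous.sum Finset.univ _ 1 fun j _ ↦ isHomogeneous_C_mul_X (p i j) j
  simpa [rowProduct] using this

/-- Positivity of every entry matters: only one coordinate is sure to have positive real part, and
each row must see it. -/
theorem rightStable_rowProduct {n : ℕ} {p : Matrix (Fin n) (Fin n) ℝ} (hp : ∀ i j, 0 < p i j) :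
    p.rowProduct.RightStable := by
  rintro z hz ⟨k, hk⟩
  rw [aeval_rowProduct]
  refine Finset.prod_ne_zero_iff.2 fun i _ h ↦ ?_
  have hre := congrArg Complex.re h
  simp only [Complex.re_sum, Complex.coe_algebraMap, Complex.re_ofReal_mul, Complex.zero_re] at hre
  exact (Finset.sum_pos' (fun j _ ↦ mul_nonneg (hp i j).le (hz j))
    ⟨k, Finset.mem_univ k, mul_pos (hp i k) hk⟩).ne' hre

theorem coeff_rowProduct {n : ℕ} (p : Matrix (Fin n) (Fin n) ℝ) :
    coeff (Finsupp.equivFunOnFinite.symm fun _ ↦ 1) p.rowProduct = p.permanent := by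
  have hmon : ∀ f : Fin n → Fin n, (∏ i, (C (p i (f i)) * X (f i) : MvPolynomial (Fin n) ℝ))
      = monomial (∑ i, Finsupp.single (f i) 1) (∏ i, p i (f i)) := by
    intro f
    simp only [C_mul_X_eq_monomial, monomial_sum_prod]
  rw [rowProduct, Fintype.prod_sum, coeff_sum]
  simp only [hmon, coeff_monomial]
  have hbij : ∀ f : Fin n → Fin n, ((∑ i, Finsupp.single (f i) 1)
      = (Finsupp.equivFunOnFinite.symm fun _ ↦ 1 : Fin n →₀ ℕ)) ↔ Function.Bijective f := by
    intro f
    rw [Function.bijective_iff_existsUnique, DFunLike.ext_iff]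
    refine forall_congr' fun j ↦ ?_
    rw [Finsupp.finsetSum_apply]
    simp only [Finsupp.single_apply, Finsupp.equivFunOnFinite_symm_apply_apply, Finset.sum_boole,
      Nat.cast_id, Finset.card_eq_one, Finset.singleton_iff_unique_mem, Finset.mem_filter,
      Finset.mem_univ, true_and]
  simp only [hbij]
  rw [← Finset.sum_filter, ← permanent_transpose]
  symm
  refine Finset.sum_bij (fun σ _ ↦ ⇑σ) (fun σ _ ↦ Finset.mem_filter.2 ⟨Finset.mem_univ _, σ.bijective⟩)
    (fun σ _ τ _ h ↦ DFunLike.coe_injective h) (fun f hf ↦ ?_) fun σ _ ↦ by simp [transpose_apply]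
  exact ⟨Equiv.ofBijective f (Finset.mem_filter.1 hf).2, Finset.mem_univ _, rfl⟩

/-- The capacity lower bound for the permanent of a non-negative matrix. -/
theorem mul_factorial_div_pow_le_permanent {n : ℕ} {p : Matrix (Fin n) (Fin n) ℝ}
    (hp : ∀ i j, 0 ≤ p i j) {c : ℝ} (hc : 0 < c)
    (hcap : ∀ x : Fin n → ℝ, (∀ i, 0 < x i) → c * ∏ i, x i ≤ ∏ i, ∑ j, p i j * x j) :
    c * ((n.factorial : ℝ) / (n : ℝ) ^ n) ≤ p.permanent := by
  -- Zero entries can break stability, so all entries are raised by `ε`, which preserves the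
  -- capacity bound; then `ε → 0`.
  have hε : ∀ ε : ℝ, 0 < ε →
      c * ((n.factorial : ℝ) / (n : ℝ) ^ n) ≤ (of fun i j ↦ p i j + ε).permanent := by
    intro ε hε
    rw [← coeff_rowProduct]
    refine (rightStable_rowProduct fun i j ↦ ?_).mul_factorial_div_pow_le_coeff
      (isHomogeneous_rowProduct _) hc fun x hx ↦ (hcap x hx).trans ?_
    · exact add_pos_of_nonneg_of_pos (hp i j) hε
    · rw [aeval_rowProduct]
      refine Finset.prod_le_prod (fun i _ ↦ Finset.sum_nonneg fun j _ ↦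
        mul_nonneg (hp i j) (hx j).le) fun i _ ↦ Finset.sum_le_sum fun j _ ↦ ?_
      exact mul_le_mul_of_nonneg_right (le_add_of_nonneg_right hε.le) (hx j).le
  have hcont : Continuous fun ε : ℝ ↦ (of fun i j ↦ p i j + ε).permanent := by
    simp only [permanent, of_apply]
    fun_prop
  have hlim := (hcont.tendsto 0).mono_left (nhdsWithin_le_nhds (s := Set.Ioi 0))
  refine ge_of_tendsto (by simpa using! hlim) ?_
  filter_upwards [self_mem_nhdsWithin] with ε h using hε ε h

/-- A doubly stochastic matrix supported in `p` bounds the capacity of `p` from below. -/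
theorem exp_mul_prod_le_prod_sum {n : ℕ} {p β : Matrix (Fin n) (Fin n) ℝ}
    (hp : ∀ i j, 0 ≤ p i j) (hβ : β ∈ doublyStochastic ℝ (Fin n))
    (hsupp : ∀ i j, β i j = 0 ↔ p i j = 0) {x : Fin n → ℝ} (hx : ∀ i, 0 < x i) :
    Real.exp (-∑ i, ∑ j, β i j * Real.log (β i j / p i j)) * ∏ i, x i
      ≤ ∏ i, ∑ j, p i j * x j := by
  obtain ⟨hβ0, hrow, hcol⟩ := mem_doublyStochastic_iff_sum.1 hβ
  have hle : ∏ i, ∏ j, (p i j * x j / β i j) ^ β i j ≤ ∏ i, ∑ j, p i j * x j := by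
    refine Finset.prod_le_prod (fun i _ ↦ Finset.prod_nonneg fun j _ ↦ Real.rpow_nonneg
      (div_nonneg (mul_nonneg (hp i j) (hx j).le) (hβ0 i j)) _) fun i _ ↦ ?_
    refine (Real.geom_mean_le_arith_mean_weighted Finset.univ (β i) (fun j ↦ p i j * x j / β i j)
      (fun j _ ↦ hβ0 i j) (hrow i) fun j _ ↦
        div_nonneg (mul_nonneg (hp i j) (hx j).le) (hβ0 i j)).trans
      (Finset.sum_le_sum fun j _ ↦ ?_)
    by_cases h : β i j = 0
    · simp [h, (hsupp i j).1 h]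
    · rw [mul_div_cancel₀ _ h]
  refine le_trans (le_of_eq ?_) hle
  have hterm : ∀ i j, (p i j * x j / β i j) ^ β i j
      = Real.exp (-(β i j * Real.log (β i j / p i j))) * x j ^ β i j := by
    intro i j
    by_cases h : β i j = 0
    · simp [h]
    · have hb : 0 < β i j := lt_of_le_of_ne (hβ0 i j) (Ne.symm h)
      have hpp : 0 < p i j := lt_of_le_of_ne (hp i j) (Ne.symm (mt (hsupp i j).2 h))
      rw [mul_div_right_comm, Real.mul_rpow (by positivity) (hx j).le,
        Real.rpow_def_of_pos (by positivity), ← inv_div (β i j), Real.log_inv]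
      ring_nf
  simp only [hterm, Finset.prod_mul_distrib]
  congr 1
  · simp only [← Real.exp_sum, Finset.sum_neg_distrib]
  · rw [Finset.prod_comm]
    -- Unit column sums collapse `∏ i, x j ^ β i j` to `x j`.
    refine Finset.prod_congr rfl fun j _ ↦ ?_
    rw [← Real.rpow_sum_of_pos (hx j), hcol j, Real.rpow_one]

end Matrix

/-! ### Cancellation of `γ` and conclusion. -/

theorem fractionalZ_mul_prod {n : ℕ} (γ : ℝ) (p : Matrix (Fin n) (Fin n) ℝ)
    {β : Matrix (Fin n) (Fin n) ℝ} (hβ : ∀ i j, β i j < 1) :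
    fractionalZ γ β p * ∏ i, ∏ j, (1 - β i j) ^ (γ * (1 - β i j))
      = Real.exp (-∑ i, ∑ j, β i j * Real.log (β i j / p i j)) := by
  have hterm : ∀ i j, (1 - β i j) ^ (γ * (1 - β i j))
      = Real.exp (γ * (1 - β i j) * Real.log (1 - β i j)) := fun i j ↦ by
    rw [Real.rpow_def_of_pos (sub_pos.2 (hβ i j)), mul_comm]
  simp only [hterm, ← Real.exp_sum, fractionalZ, fractionalFreeEnergy, ← Real.exp_add,
    Finset.sum_add_distrib]
  congr 1
  ring

theorem mainTheorem5 {n : ℕ} (γ : ℝ) (hγ : γ ∈ Set.Icc (-1 : ℝ) 1)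
    (p : Matrix (Fin n) (Fin n) ℝ) (hp : ∀ i j, 0 ≤ p i j)
    (β : Matrix (Fin n) (Fin n) ℝ) (hβ : β ∈ betaPolytopeInterior p)
    (hsol : SolvesFractionalEquations γ p β) :
    p.permanent ≥ fractionalZ γ β p * ((n.factorial : ℝ) / (n : ℝ) ^ n) *
      ∏ i, ∏ j, (1 - β i j) ^ (γ * (1 - β i j)) := by
  obtain ⟨⟨hds, hzero⟩, hint⟩ := hβ
  have hlt : ∀ i j, β i j < 1 := fun i j ↦ by
    refine lt_of_le_of_ne (le_one_of_mem_doublyStochastic hds) ?_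
    by_cases h : p i j = 0
    · simp [hzero i j h]
    · exact (hint i j h).2
  have hsupp : ∀ i j, β i j = 0 ↔ p i j = 0 := fun i j ↦
    ⟨fun h ↦ by_contra fun hpij ↦ (hint i j hpij).1 h, hzero i j⟩
  rw [mul_right_comm, fractionalZ_mul_prod γ p hlt]
  exact Matrix.mul_factorial_div_pow_le_permanent hp (Real.exp_pos _) fun x hx ↦
    Matrix.exp_mul_prod_le_prod_sum hp hds hsupp hx
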